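/- For real parameters $H$ and $t>0$ put $$D(H,t,x)=\sqrt{\Bigl(\frac{x}{Hx^2+t-Ht^2}\Bigr)^2-1}.$$ The Delaunay profile with mean curvature $H$ and neck/bulge radius $t$ is the positive, strictly decreasing solution $x_1=c(H,t,x_3)$, $x_3\ge 0$, of $$\frac{dx_1}{dx_3}=-D(H,t,x_1),\qquad x_1(0)=t$$ (rotated about the $x_3$-axis it generates a surface of constant mean curvature $H$; for $H=t=1$ it is the unit circle). For $a\in(0,1)$ and $t$ near $1$ let $x_a(t)$ be the height $x_3$ at which the profile with $H=1$ reaches $x_1=a$, and let $f(a,t)=x_a(t)-\sqrt{1-a^2}$. Define, for $a\in(0,1)$, $$g(a)=-\ln\frac{1+\sqrt{1-a^2}}{a}+\frac{1}{\sqrt{1-a^2}},\qquad h(a)=\ln\frac{1+\sqrt{1-a^2}}{a}+\frac{a^2-2}{(1-a^2)^{3/2}}.$$ **Lemma.** The function $g$ has a unique zero $a_0$ in $(0,1)$; it satisfies $\tfrac12<a_0<1$ and $|a_0-0.5524|<5\cdot10^{-5}$, and $h(a_0)=-(1-a_0^2)^{-3/2}<0$. For every $a\in(0,1)$ there is $\eta_a>0$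 such that for $|t-1|\le\eta_a$ the height $x_a(t)$ exists and is unique, $f(a,\cdot)$ is differentiable at every such $t$, $x_a(1)=\sqrt{1-a^2}$, $$\frac{\partial f}{\partial t}(a,1)=g(a),\qquad \frac{\partial^2 f}{\partial t^2}(a,1)=h(a),$$ and moreover: 1. if $a>a_0$, then $g(a)>0$, and $x_a(t)<\sqrt{1-a^2}$ for $1-\eta_a\le t<1$, while $x_a(t)>\sqrt{1-a^2}$ for $1<t\le 1+\eta_a$; 2. if $a<a_0$, then $g(a)<0$, and $x_a(t)>\sqrt{1-a^2}$ for $1-\eta_a\le t<1$, while $x_a(t)<\sqrt{1-a^2}$ for $1<t\le 1+\eta_a$; 3. if $a=a_0$, then $x_a(t)<\sqrt{1-a^2}$ for $0<|t-1|\le\eta_a$. -/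

import Mathlib

open Real Set

noncomputable section

/-- The quotient `x / (H x² + t - H t²)`: along the generating curve `x₁ = c(x₃)` with parameters
`H`, `t` it equals `√(1 + c'²)`. -/
def delaunayQuotient (H t x : ℝ) : ℝ := x / (H * x ^ 2 + t - H * t ^ 2)

/-- `D(H,t,x) = √((x / (H x² + t - H t²))² - 1)`, the absolute slope `|dx₁/dx₃|` of the generating
curve at the point with `x₁ = x`. -/
def delaunaySlope (H t x : ℝ) : ℝ := √(delaunayQuotient H t x ^ 2 - 1)

/-- On `0 ≤ x₃ ≤ L` the curve `x₁ = c x₃` is the upper half of the generating curve of the rotation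
surface of mean curvature `H` (a Delaunay surface) with axis the `x₃`-axis, which crosses the plane
`x₃ = 0` horizontally at radius `t`: the positive, strictly decreasing solution of
`dx₁/dx₃ = -D(H,t,x₁)`, `x₁(0) = t`. The field `admissible` says that the number under the root in
`D` is nonnegative along the curve (in particular the denominator there does not vanish). -/
structure IsDelaunayProfile (H t L : ℝ) (c : ℝ → ℝ) : Prop where
  init : c 0 = t
  pos : ∀ s ∈ Icc 0 L, 0 < c s
  strictAnti : StrictAntiOn c (Icc 0 L)
  admissible : ∀ s ∈ Icc 0 L, 1 ≤ delaunayQuotient H t (c s) ^ 2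
  ode : ∀ s ∈ Icc 0 L, HasDerivWithinAt c (-delaunaySlope H t (c s)) (Icc 0 L) s

/-- The set of heights `s ≥ 0` at which a profile with parameters `H`, `t` reaches `x₁ = a`. -/
def delaunayHeights (a H t : ℝ) : Set ℝ :=
  {s | 0 ≤ s ∧ ∃ c : ℝ → ℝ, IsDelaunayProfile H t s c ∧ c s = a}

/-- `x*(a,H,t)`, the height at which the profile with parameters `H`, `t` reaches `x₁ = a`. It is
meaningful when `delaunayHeights a H t` is a singleton, and is then its only element. -/
def delaunayHeight (a H t : ℝ) : ℝ := sInf (delaunayHeights a H t)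

/-- `f(a,t) = x_a(t) - √(1 - a²)`, where `x_a(t) = x*(a,1,t)`. -/
def heightExcess (a t : ℝ) : ℝ := delaunayHeight a 1 t - √(1 - a ^ 2)

/-- `g(a) = -ln ((1 + √(1 - a²)) / a) + 1 / √(1 - a²)`. -/
def gFun (a : ℝ) : ℝ := -Real.log ((1 + √(1 - a ^ 2)) / a) + 1 / √(1 - a ^ 2)

/-- `h(a) = ln ((1 + √(1 - a²)) / a) + (a² - 2) / (1 - a²)^(3/2)`. -/
def hFun (a : ℝ) : ℝ :=
  Real.log ((1 + √(1 - a ^ 2)) / a) + (a ^ 2 - 2) / (1 - a ^ 2) ^ (3 / 2 : ℝ)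

end

/-! The slope `D` vanishes at `x₁ = t`, so the height integral `∫ dx₁ / D` is singular there. The
substitution `x₁² = t² cos² φ + (1-t)² sin² φ` removes the singularity: since `x₁² - (1-t)² = (2t-1)
cos² φ` and `t² - x₁² = (2t-1) sin² φ`, the ODE becomes `dx₃/dφ = r + t(1-t)/r` with `r = x₁`,
smooth and positive down to `φ = 0`. Hence `x_a(t)` is the integral of this density from `0` to the
angle at which `r = a` (`Reaches.delaunayHeights_eq`).

Differentiating twice in `t`, with a moving upper limit, gives elementary integrals at `t = 1`,
where `r = cos φ`; they evaluate to `g(a)` and `h(a)` (`angleHeightDeriv_one`,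
`hasDerivAt_angleHeightDeriv_one`). For `a ≠ a₀` the sign of `f` near `t = 1` is decided by `g`,
which is strictly increasing with zero `a₀`; at `a₀` the first derivative vanishes and `h(a₀) < 0`
makes `t = 1` a strict local maximum. -/

/-! ### Calculus tools: parameter integrals and inverses of integrals -/

theorem hasDerivAt_intervalIntegral_of_continuousOn {w w' : ℝ → ℝ → ℝ} {U : Set (ℝ × ℝ)}
    (hU : IsOpen U) (hw : ContinuousOn (Function.uncurry w) U)
    (hw' : ContinuousOn (Function.uncurry w') U)
    (hd : ∀ p ∈ U, HasDerivAt (fun t => w t p.2) (w' p.1 p.2) p.1)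
    {b : ℝ → ℝ} {b' t₀ : ℝ} (hb : HasDerivAt b b' t₀)
    (hseg : ∀ φ ∈ uIcc 0 (b t₀), (t₀, φ) ∈ U) :
    HasDerivAt (fun t => ∫ φ in (0 : ℝ)..b t, w t φ)
      ((∫ φ in (0 : ℝ)..b t₀, w' t₀ φ) + w t₀ (b t₀) * b') t₀ := by
  -- A product neighbourhood `u ×ˢ v ⊆ U`: `v` is open, so it leaves room for the limit `b t` to
  -- move past `b t₀`.
  obtain ⟨u, v, hu, hv, htu, hsv, huv⟩ := generalized_tube_lemma (isCompact_singleton (x := t₀))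
    (isCompact_uIcc (a := (0 : ℝ)) (b := b t₀)) hU (by
      rintro ⟨t, φ⟩ ⟨ht, hφ⟩
      rw [mem_singleton_iff] at ht
      simp only at ht hφ
      rw [ht]
      exact hseg φ hφ)
  have htu' : t₀ ∈ u := htu rfl
  obtain ⟨ε, hε, hεu⟩ := Metric.nhds_basis_closedBall.mem_iff.1 (hu.mem_nhds htu')
  have hslice : ∀ {f : ℝ → ℝ → ℝ}, ContinuousOn (Function.uncurry f) U → ∀ t ∈ u,
      ContinuousOn (f t) v := by
    intro f hf t ht
    exact hf.comp (f := fun φ => (t, φ)) (by fun_prop) (fun φ hφ => huv ⟨ht, hφ⟩)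
  have hball : Metric.ball t₀ ε ⊆ u := Metric.ball_subset_closedBall.trans hεu
  have hnear : ∀ᶠ t in nhds t₀, t ∈ u := hu.mem_nhds htu'
  -- the part with fixed limits
  have hA : HasDerivAt (fun t => ∫ φ in (0 : ℝ)..b t₀, w t φ)
      (∫ φ in (0 : ℝ)..b t₀, w' t₀ φ) t₀ := by
    have hK : IsCompact (Metric.closedBall t₀ ε ×ˢ uIcc 0 (b t₀)) :=
      (isCompact_closedBall _ _).prod isCompact_uIcc
    obtain ⟨C, hC⟩ := hK.exists_bound_of_continuousOn
      (hw'.mono fun p hp => huv ⟨hεu hp.1, hsv hp.2⟩)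
    refine (intervalIntegral.hasDerivAt_integral_of_dominated_loc_of_deriv_le
      (F := w) (F' := w') (bound := fun _ => C) (Metric.ball_mem_nhds t₀ hε)
      ?_ ?_ ?_ ?_ ?_ ?_).2
    · filter_upwards [hnear] with t ht
      exact (((hslice hw t ht).mono hsv).intervalIntegrable (μ := MeasureTheory.volume)).def'.aestronglyMeasurable
    · exact ((hslice hw t₀ htu').mono hsv).intervalIntegrable
    · exact (((hslice hw' t₀ htu').mono hsv).intervalIntegrable (μ := MeasureTheory.volume)).def'.aestronglyMeasurable
    · refine Filter.Eventually.of_forall fun φ hφ t ht => ?_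
      exact hC (t, φ) ⟨Metric.ball_subset_closedBall ht, uIoc_subset_uIcc hφ⟩
    · exact intervalIntegrable_const
    · refine Filter.Eventually.of_forall fun φ hφ t ht => ?_
      exact hd (t, φ) (huv ⟨hball ht, hsv (uIoc_subset_uIcc hφ)⟩)
  -- the part with a moving limit
  have hbv : b t₀ ∈ v := hsv right_mem_uIcc
  obtain ⟨δ, hδ, hδv⟩ := Metric.mem_nhds_iff.1 (hv.mem_nhds hbv)
  have hbnear : ∀ {ρ : ℝ}, 0 < ρ → ∀ᶠ t in nhds t₀, uIcc (b t₀) (b t) ⊆ Metric.ball (b t₀) ρ := by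
    intro ρ hρ
    filter_upwards [hb.continuousAt (Metric.ball_mem_nhds _ hρ)] with t ht
    exact (convex_ball _ _).ordConnected.uIcc_subset (Metric.mem_ball_self hρ) ht
  have hB : HasDerivAt (fun t => ∫ φ in (b t₀)..b t, w t φ) (w t₀ (b t₀) * b') t₀ := by
    have h1 : HasDerivAt (fun t => w t₀ (b t₀) * (b t - b t₀)) (w t₀ (b t₀) * b') t₀ :=
      (hb.sub_const _).const_mul _
    -- Freezing the integrand at `(t₀, b t₀)` costs at most `c * |b t - b t₀|` by joint continuity,
    -- and `b t - b t₀ = O(t - t₀)`.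
    have h2 : HasDerivAt (fun t => (∫ φ in (b t₀)..b t, w t φ) - w t₀ (b t₀) * (b t - b t₀))
        0 t₀ := by
      rw [hasDerivAt_iff_isLittleO]
      have hO : (fun t => b t - b t₀) =O[nhds t₀] fun t => t - t₀ := hb.isBigO_sub
      refine Asymptotics.IsLittleO.trans_isBigO ?_ hO
      rw [Asymptotics.isLittleO_iff]
      intro c hc
      have hcont : ContinuousAt (Function.uncurry w) (t₀, b t₀) :=
        hw.continuousAt (hU.mem_nhds (huv ⟨htu', hbv⟩))
      obtain ⟨ρ, hρ, hρc⟩ := Metric.continuousAt_iff.1 hcont c hc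
      filter_upwards [hnear, hbnear hδ, hbnear hρ, Metric.ball_mem_nhds t₀ hρ]
        with t ht htδ htρ htball
      have hint : IntervalIntegrable (w t) MeasureTheory.volume (b t₀) (b t) :=
        ((hslice hw t ht).mono (htδ.trans hδv)).intervalIntegrable
      have heq : (∫ φ in (b t₀)..b t, w t φ) - w t₀ (b t₀) * (b t - b t₀)
          = ∫ φ in (b t₀)..b t, (w t φ - w t₀ (b t₀)) := by
        rw [intervalIntegral.integral_sub hint intervalIntegrable_const,
          intervalIntegral.integral_const, smul_eq_mul, mul_comm]
      simp only [intervalIntegral.integral_same, sub_self, mul_zero, smul_zero, sub_zero]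
      rw [heq]
      refine intervalIntegral.norm_integral_le_of_norm_le_const fun φ hφ => ?_
      have hmem := htρ (uIoc_subset_uIcc hφ)
      have := hρc (x := (t, φ)) (by
        rw [Prod.dist_eq]
        exact max_lt htball hmem)
      rw [dist_eq_norm] at this
      exact this.le
    refine ((h2.add h1).congr_deriv (zero_add _)).congr_of_eventuallyEq
      (Filter.Eventually.of_forall fun t => ?_)
    simp
  refine (hA.add hB).congr_of_eventuallyEq ?_
  filter_upwards [hnear, hbnear hδ] with t ht htδ
  exact (intervalIntegral.integral_add_adjacent_intervals
    ((hslice hw t ht).mono hsv).intervalIntegrable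
    ((hslice hw t ht).mono (htδ.trans hδv)).intervalIntegrable).symm

theorem hasDerivAt_arccos_sqrt {y : ℝ → ℝ} {y' x : ℝ} (hy : HasDerivAt y y' x) (h0 : 0 < y x)
    (h1 : y x < 1) :
    HasDerivAt (fun z => arccos √(y z)) (-y' / (2 * √(y x * (1 - y x)))) x := by
  have hs := hy.sqrt h0.ne'
  have hpos : 0 < √(y x) := sqrt_pos.2 h0
  have hlt : √(y x) < 1 := by rwa [sqrt_lt' one_pos, one_pow]
  have h := (Real.hasDerivAt_arccos (x := √(y x)) (by linarith) hlt.ne).comp x hs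
  refine h.congr_deriv ?_
  rw [sq_sqrt h0.le, sqrt_mul h0.le]
  have : 0 < √(1 - y x) := sqrt_pos.2 (by linarith)
  field_simp

/-- The bound `m` forces at least linear growth of the integral, hence surjectivity. An inverse on
all of `ℝ` avoids one-sided derivatives at the ends of the profile. -/
theorem exists_inverse_integral {W : ℝ → ℝ} (hW : Continuous W) {m : ℝ} (hm : 0 < m)
    (hmW : ∀ x, m ≤ W x) :
    ∃ ϑ : ℝ → ℝ, StrictMono ϑ ∧ (∀ x, ϑ (∫ φ in (0 : ℝ)..x, W φ) = x) ∧
      ∀ s, HasDerivAt ϑ (W (ϑ s))⁻¹ s := by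
  have hder : ∀ x, HasDerivAt (fun x => ∫ φ in (0 : ℝ)..x, W φ) (W x) x := fun x =>
    intervalIntegral.integral_hasDerivAt_right (hW.intervalIntegrable _ _)
      (hW.stronglyMeasurableAtFilter _ _) hW.continuousAt
  set Z : ℝ → ℝ := fun x => ∫ φ in (0 : ℝ)..x, W φ with hZ
  have hpos : ∀ x, 0 < W x := fun x => hm.trans_le (hmW x)
  have hmono : StrictMono Z := strictMono_of_deriv_pos fun x => by
    rw [(hder x).deriv]; exact hpos x
  have hcont : Continuous Z := continuous_iff_continuousAt.2 fun x => (hder x).continuousAt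
  have hgap : Monotone fun x => Z x - m * x := by
    refine monotone_of_deriv_nonneg (fun x => ((hder x).sub ((hasDerivAt_id x).const_mul m)).differentiableAt) fun x => ?_
    have := ((hder x).sub ((hasDerivAt_id x).const_mul m)).deriv
    simp only [id, mul_one] at this
    have h2 : deriv (fun x => Z x - m * x) x = W x - m := this
    rw [h2]; linarith [hmW x]
  have hZ0 : Z 0 = 0 := by simp [hZ]
  have hsurj : Function.Surjective Z := by
    refine hcont.surjective ?_ ?_
    · refine Filter.tendsto_atTop_mono' _ ?_ (Filter.tendsto_id.const_mul_atTop hm)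
      filter_upwards [Filter.eventually_ge_atTop 0] with x hx
      have := hgap hx
      simp only [hZ0, mul_zero, sub_zero, id] at this ⊢
      linarith
    · refine Filter.tendsto_atBot_mono' _ ?_ (Filter.tendsto_id.const_mul_atBot hm)
      filter_upwards [Filter.eventually_le_atBot 0] with x hx
      have := hgap hx
      simp only [hZ0, mul_zero, sub_zero, id] at this ⊢
      linarith
  let e := hmono.orderIsoOfSurjective Z hsurj
  have he : ∀ x, Z (e.symm x) = x := fun x => e.apply_symm_apply x
  refine ⟨e.symm, e.symm.strictMono, fun x => e.symm_apply_apply x, fun s => ?_⟩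
  exact (hder (e.symm s)).of_local_left_inverse e.symm.continuous.continuousAt
    (hpos _).ne' (Filter.Eventually.of_forall he)

/-! ### The angle substitution and existence and uniqueness of the height -/

/-- The squared radius `x₁²` of the profile with `H = 1` and radius `t`, as a function of the
angle `φ` with `x₁² = t² cos² φ + (1 - t)² sin² φ`. -/
noncomputable def angleRadiusSq (t φ : ℝ) : ℝ := (1 - t) ^ 2 + (2 * t - 1) * cos φ ^ 2

/-- The derivative of the height with respect to the angle. -/
noncomputable def heightDensity (t φ : ℝ) : ℝ := √(angleRadiusSq t φ) + t * (1 - t) / √(angleRadiusSq t φ)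

/-- The angle at which the profile with `H = 1` and radius `t` has radius `x`. -/
noncomputable def radiusAngle (t x : ℝ) : ℝ := arccos √((x ^ 2 - (1 - t) ^ 2) / (2 * t - 1))

/-- The height as an integral over the angle. -/
noncomputable def angleHeight (a t : ℝ) : ℝ := ∫ φ in (0 : ℝ)..radiusAngle t a, heightDensity t φ

/-- The profile with `H = 1` and radius `t` descends from radius `t` to radius `a`. -/
structure Reaches (a t : ℝ) : Prop where
  pos : 0 < a
  lt : a < t
  -- `|1 - t|` is the other radius at which `D` vanishes. The last condition keeps `x² + t - t²`
  -- positive for `x ≥ a`; it is a genuine restriction only for `t > 1`.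
  abs_lt : |1 - t| < a
  denom : t ^ 2 - t < a ^ 2

namespace Reaches

variable {a t : ℝ}

theorem coeff_pos (h : Reaches a t) : 0 < 2 * t - 1 := by
  have := le_abs_self (1 - t)
  linarith [h.abs_lt, h.lt]

theorem sq_lt (h : Reaches a t) : (1 - t) ^ 2 < a ^ 2 := by
  rw [← sq_abs (1 - t)]
  have := abs_nonneg (1 - t)
  have := h.abs_lt
  gcongr

theorem mono (h : Reaches a t) {x : ℝ} (hax : a ≤ x) (hxt : x < t) : Reaches x t :=
  ⟨h.pos.trans_le hax, hxt, h.abs_lt.trans_le hax,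
    h.denom.trans_le (pow_le_pow_left₀ h.pos.le hax 2)⟩

theorem ratio_pos (h : Reaches a t) : 0 < (a ^ 2 - (1 - t) ^ 2) / (2 * t - 1) :=
  div_pos (sub_pos.2 h.sq_lt) h.coeff_pos

theorem ratio_lt_one (h : Reaches a t) : (a ^ 2 - (1 - t) ^ 2) / (2 * t - 1) < 1 := by
  rw [div_lt_one h.coeff_pos]
  nlinarith [h.pos, h.lt]

theorem cos_radiusAngle (h : Reaches a t) :
    cos (radiusAngle t a) = √((a ^ 2 - (1 - t) ^ 2) / (2 * t - 1)) :=
  cos_arccos (by linarith [sqrt_nonneg ((a ^ 2 - (1 - t) ^ 2) / (2 * t - 1))])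
    (sqrt_le_one.2 h.ratio_lt_one.le)

theorem angleRadiusSq_radiusAngle (h : Reaches a t) :
    angleRadiusSq t (radiusAngle t a) = a ^ 2 := by
  have := h.coeff_pos.ne'
  rw [angleRadiusSq, h.cos_radiusAngle, sq_sqrt h.ratio_pos.le,
    mul_div_cancel₀ _ this]
  ring

theorem radiusAngle_pos (h : Reaches a t) : 0 < radiusAngle t a :=
  arccos_pos.2 (by rw [sqrt_lt' one_pos, one_pow]; exact h.ratio_lt_one)

theorem radiusAngle_lt (h : Reaches a t) : radiusAngle t a < π / 2 :=
  arccos_lt_pi_div_two.2 (sqrt_pos.2 h.ratio_pos)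

theorem angleRadiusSq_strictAntiOn (h : Reaches a t) :
    StrictAntiOn (angleRadiusSq t) (Icc 0 (π / 2)) := by
  intro x hx y hy hxy
  have hcos : cos y < cos x := cos_lt_cos_of_nonneg_of_le_pi_div_two hx.1 hy.2 hxy
  have hy0 : 0 ≤ cos y := cos_nonneg_of_neg_pi_div_two_le_of_le (by linarith [hy.1, pi_pos]) hy.2
  have := h.coeff_pos
  simp only [angleRadiusSq]
  gcongr

theorem le_angleRadiusSq (h : Reaches a t) {φ : ℝ} (hφ : φ ∈ Icc 0 (radiusAngle t a)) :
    a ^ 2 ≤ angleRadiusSq t φ := by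
  rw [← h.angleRadiusSq_radiusAngle]
  exact h.angleRadiusSq_strictAntiOn.antitoneOn ⟨hφ.1, hφ.2.trans h.radiusAngle_lt.le⟩
    ⟨h.radiusAngle_pos.le, h.radiusAngle_lt.le⟩ hφ.2

theorem angleRadiusSq_pos (h : Reaches a t) {φ : ℝ} (hφ : φ ∈ Icc 0 (radiusAngle t a)) :
    0 < angleRadiusSq t φ :=
  (pow_pos h.pos 2).trans_le (h.le_angleRadiusSq hφ)

theorem heightDensity_pos (h : Reaches a t) {φ : ℝ} (hφ : φ ∈ Icc 0 (radiusAngle t a)) :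
    0 < heightDensity t φ := by
  have h0 := h.angleRadiusSq_pos hφ
  have hr : 0 < √(angleRadiusSq t φ) := sqrt_pos.2 h0
  have : heightDensity t φ = (angleRadiusSq t φ + t * (1 - t)) / √(angleRadiusSq t φ) := by
    rw [heightDensity, add_div, div_sqrt]
  rw [this]
  refine div_pos ?_ hr
  linarith [h.le_angleRadiusSq hφ, h.denom]

theorem heightDensity_radiusAngle (h : Reaches a t) :
    heightDensity t (radiusAngle t a) = a + t * (1 - t) / a := by
  rw [heightDensity, h.angleRadiusSq_radiusAngle, sqrt_sq h.pos.le]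

theorem continuousOn_heightDensity (h : Reaches a t) :
    ContinuousOn (heightDensity t) (Icc 0 (radiusAngle t a)) := by
  have hX : Continuous (angleRadiusSq t) := by unfold angleRadiusSq; fun_prop
  have hr : Continuous fun φ => √(angleRadiusSq t φ) := hX.sqrt
  exact hr.continuousOn.add (continuousOn_const.div hr.continuousOn
    fun φ hφ => (sqrt_pos.2 (h.angleRadiusSq_pos hφ)).ne')

theorem hasDerivAt_radiusAngle (h : Reaches a t) :
    HasDerivAt (radiusAngle t) (-a / √((a ^ 2 - (1 - t) ^ 2) * (t ^ 2 - a ^ 2))) a := by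
  have hy : HasDerivAt (fun x : ℝ => (x ^ 2 - (1 - t) ^ 2) / (2 * t - 1))
      (2 * a / (2 * t - 1)) a := by
    simpa using (((hasDerivAt_id a).pow 2).sub_const ((1 - t) ^ 2)).div_const (2 * t - 1)
  refine (hasDerivAt_arccos_sqrt hy h.ratio_pos h.ratio_lt_one).congr_deriv ?_
  have hm := h.coeff_pos
  have h1 : (a ^ 2 - (1 - t) ^ 2) / (2 * t - 1) * (1 - (a ^ 2 - (1 - t) ^ 2) / (2 * t - 1))
      = (a ^ 2 - (1 - t) ^ 2) * (t ^ 2 - a ^ 2) / (2 * t - 1) ^ 2 := by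
    rw [one_sub_div hm.ne', div_mul_div_comm, ← pow_two]
    congr 1
    ring
  rw [h1, sqrt_div' _ (sq_nonneg _), sqrt_sq hm.le]
  have h2 : 0 < √((a ^ 2 - (1 - t) ^ 2) * (t ^ 2 - a ^ 2)) :=
    sqrt_pos.2 (mul_pos (sub_pos.2 h.sq_lt) (by nlinarith [h.pos, h.lt]))
  field_simp

theorem delaunaySlope_eq (h : Reaches a t) :
    delaunaySlope 1 t a
      = √((a ^ 2 - (1 - t) ^ 2) * (t ^ 2 - a ^ 2)) / (a ^ 2 + t * (1 - t)) := by
  have hd : 0 < a ^ 2 + t * (1 - t) := by linarith [h.denom]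
  have hd' : 1 * a ^ 2 + t - 1 * t ^ 2 = a ^ 2 + t * (1 - t) := by ring
  have : delaunayQuotient 1 t a ^ 2 - 1
      = (a ^ 2 - (1 - t) ^ 2) * (t ^ 2 - a ^ 2) / (a ^ 2 + t * (1 - t)) ^ 2 := by
    rw [delaunayQuotient, hd']
    field_simp
    ring
  rw [delaunaySlope, this, sqrt_div' _ (sq_nonneg _), sqrt_sq hd.le]

/-- The height density frozen outside the range of angles of the profile. -/
theorem exists_extension (h : Reaches a t) : ∃ W : ℝ → ℝ, Continuous W ∧
    (∃ m, 0 < m ∧ ∀ x, m ≤ W x) ∧ EqOn W (heightDensity t) (Icc 0 (radiusAngle t a)) := by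
  have hle := h.radiusAngle_pos.le
  have hc := h.continuousOn_heightDensity
  obtain ⟨x₀, hx₀, hmin⟩ := isCompact_Icc.exists_isMinOn (nonempty_Icc.2 hle) hc
  refine ⟨IccExtend hle (domRestrict (Icc 0 (radiusAngle t a)) (heightDensity t)),
    (continuousOn_iff_continuous_domRestrict.1 hc).Icc_extend',
    ⟨heightDensity t x₀, h.heightDensity_pos hx₀, fun x => ?_⟩, fun x hx => ?_⟩
  · exact hmin (projIcc 0 (radiusAngle t a) hle x).2
  · rw [IccExtend_of_mem hle _ hx]; rfl

theorem angleHeight_eq (h : Reaches a t) {W : ℝ → ℝ}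
    (hW : EqOn W (heightDensity t) (Icc 0 (radiusAngle t a))) :
    ∫ φ in (0 : ℝ)..radiusAngle t a, W φ = angleHeight a t := by
  refine intervalIntegral.integral_congr ?_
  rw [uIcc_of_le h.radiusAngle_pos.le]
  exact hW

theorem angleHeight_pos (h : Reaches a t) : 0 < angleHeight a t := by
  refine intervalIntegral.intervalIntegral_pos_of_pos_on ?_ (fun x hx =>
    h.heightDensity_pos (Ioo_subset_Icc_self hx)) h.radiusAngle_pos
  refine ContinuousOn.intervalIntegrable ?_
  rw [uIcc_of_le h.radiusAngle_pos.le]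
  exact h.continuousOn_heightDensity

theorem radiusAngle_self (h : Reaches a t) : radiusAngle t t = 0 := by
  have hm := h.coeff_pos.ne'
  have : (t ^ 2 - (1 - t) ^ 2) / (2 * t - 1) = 1 := by
    rw [div_eq_one_iff_eq hm]
    ring
  rw [radiusAngle, this, sqrt_one, arccos_one]

/-- Along any profile the height recovered from the angle of `c x` grows at rate 1, so `s` is
forced. Strict decrease keeps `c` inside `(a, t)` and rules out the constant solution `c = t` of the
ODE. -/
theorem height_eq_of_profile (h : Reaches a t) {s : ℝ} (hs : 0 ≤ s) {c : ℝ → ℝ}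
    (hc : IsDelaunayProfile 1 t s c) (hcs : c s = a) : s = angleHeight a t := by
  have hs0 : 0 < s := by
    refine hs.lt_of_ne fun h0 => ?_
    rw [← h0, hc.init] at hcs
    exact h.lt.ne hcs.symm
  obtain ⟨W, hWc, -, hW⟩ := h.exists_extension
  set Z : ℝ → ℝ := fun x => ∫ φ in (0 : ℝ)..x, W φ with hZ
  have hZd : ∀ x, HasDerivAt Z (W x) x := fun x =>
    intervalIntegral.integral_hasDerivAt_right (hWc.intervalIntegrable _ _)
      (hWc.stronglyMeasurableAtFilter _ _) hWc.continuousAt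
  have hZc : Continuous Z := continuous_iff_continuousAt.2 fun x => (hZd x).continuousAt
  have hcc : ContinuousOn c (Icc 0 s) := fun x hx => (hc.ode x hx).continuousWithinAt
  have hΘc : Continuous (radiusAngle t) := by
    unfold radiusAngle
    exact continuous_arccos.comp (by fun_prop)
  have hcont : ContinuousOn (fun x => Z (radiusAngle t (c x))) (Icc 0 s) :=
    (hZc.comp hΘc).comp_continuousOn hcc
  have hder : ∀ x ∈ Ioo 0 s, HasDerivAt (fun x => Z (radiusAngle t (c x))) 1 x := by
    intro x hx
    have hxI : x ∈ Icc 0 s := Ioo_subset_Icc_self hx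
    have hlt : c x < t := by
      rw [← hc.init]; exact hc.strictAnti (left_mem_Icc.2 hs) hxI hx.1
    have hgt : a < c x := by
      rw [← hcs]; exact hc.strictAnti hxI (right_mem_Icc.2 hs) hx.2
    have hx' := h.mono hgt.le hlt
    have hmem : radiusAngle t (c x) ∈ Icc 0 (radiusAngle t a) := by
      refine ⟨hx'.radiusAngle_pos.le, arccos_le_arccos (sqrt_le_sqrt ?_)⟩
      have := h.coeff_pos
      have := h.pos
      gcongr
    have hcd := (hc.ode x hxI).hasDerivAt (Icc_mem_nhds hx.1 hx.2)
    refine ((hZd _).comp x (hx'.hasDerivAt_radiusAngle.comp x hcd)).congr_deriv ?_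
    rw [Function.comp_apply, hW hmem, hx'.heightDensity_radiusAngle, hx'.delaunaySlope_eq]
    have h2 : 0 < √((c x ^ 2 - (1 - t) ^ 2) * (t ^ 2 - c x ^ 2)) :=
      sqrt_pos.2 (mul_pos (sub_pos.2 hx'.sq_lt) (by nlinarith [hx'.pos, hx'.lt]))
    have hd : 0 < c x ^ 2 + t * (1 - t) := by linarith [hx'.denom]
    have := hx'.pos
    field_simp
  -- The mean value theorem needs derivatives only in the interior; at `x = 0` the angle is not a
  -- differentiable function of the radius.
  obtain ⟨ξ, -, hξ⟩ := exists_hasDerivAt_eq_slope _ _ hs0 hcont hder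
  simp only [hcs, hc.init, h.radiusAngle_self] at hξ
  rw [eq_div_iff (by linarith)] at hξ
  have h0 : Z 0 = 0 := by simp [hZ]
  have ha : Z (radiusAngle t a) = angleHeight a t := h.angleHeight_eq hW
  rw [h0, ha] at hξ
  linarith

/-- Inverting height as a function of angle gives `ϑ`, and the profile is the radius at angle `ϑ s`.
-/
theorem exists_profile (h : Reaches a t) :
    ∃ c, IsDelaunayProfile 1 t (angleHeight a t) c ∧ c (angleHeight a t) = a := by
  obtain ⟨W, hWc, ⟨m, hm, hmW⟩, hW⟩ := h.exists_extension
  obtain ⟨ϑ, hmono, hinv, hder⟩ := exists_inverse_integral hWc hm hmW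
  have h0 : ϑ 0 = 0 := by simpa using hinv 0
  have ha : ϑ (angleHeight a t) = radiusAngle t a := by
    rw [← h.angleHeight_eq hW]; exact hinv _
  have hmem : ∀ s ∈ Icc 0 (angleHeight a t), ϑ s ∈ Icc 0 (radiusAngle t a) := by
    intro s hs
    rw [← ha, ← h0]
    exact ⟨hmono.monotone hs.1, hmono.monotone hs.2⟩
  have hmem' : ∀ s ∈ Icc 0 (angleHeight a t), ϑ s ∈ Icc 0 (π / 2) := fun s hs =>
    ⟨(hmem s hs).1, (hmem s hs).2.trans h.radiusAngle_lt.le⟩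
  have hden : ∀ s ∈ Icc 0 (angleHeight a t), 0 < angleRadiusSq t (ϑ s) + t * (1 - t) := by
    intro s hs
    linarith [h.le_angleRadiusSq (hmem s hs), h.denom]
  -- With `X = x₁²`, `X - (X + t(1-t))² = (X - (1-t)²)(t² - X)`, which is a perfect square in terms
  -- of the angle.
  have hquot : ∀ s ∈ Icc 0 (angleHeight a t),
      delaunayQuotient 1 t √(angleRadiusSq t (ϑ s)) ^ 2 - 1 =
        ((2 * t - 1) * sin (ϑ s) * cos (ϑ s) / (angleRadiusSq t (ϑ s) + t * (1 - t))) ^ 2 := by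
    intro s hs
    have hX := h.angleRadiusSq_pos (hmem s hs)
    have hd := hden s hs
    have hd' : 1 * angleRadiusSq t (ϑ s) + t - 1 * t ^ 2
        = angleRadiusSq t (ϑ s) + t * (1 - t) := by ring
    rw [delaunayQuotient, div_pow, sq_sqrt hX.le, hd', div_pow, mul_pow, mul_pow, sin_sq]
    rw [eq_div_iff (by positivity), sub_mul, div_mul_cancel₀ _ (by positivity), one_mul]
    simp only [angleRadiusSq]
    ring
  have hm0 := h.coeff_pos
  refine ⟨fun s => √(angleRadiusSq t (ϑ s)), ⟨?_, ?_, ?_, ?_, ?_⟩, ?_⟩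
  · have : angleRadiusSq t 0 = t ^ 2 := by simp only [angleRadiusSq, cos_zero]; ring
    simp only [h0, this]
    exact sqrt_sq (h.pos.trans h.lt).le
  · exact fun s hs => sqrt_pos.2 (h.angleRadiusSq_pos (hmem s hs))
  · intro s hs s' hs' hlt
    exact sqrt_lt_sqrt (h.angleRadiusSq_pos (hmem s' hs')).le
      (h.angleRadiusSq_strictAntiOn (hmem' s hs) (hmem' s' hs') (hmono hlt))
  · intro s hs
    have := hquot s hs
    nlinarith [sq_nonneg ((2 * t - 1) * sin (ϑ s) * cos (ϑ s) /
      (angleRadiusSq t (ϑ s) + t * (1 - t)))]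
  · intro s hs
    have hX := h.angleRadiusSq_pos (hmem s hs)
    have hd := hden s hs
    have hsin : 0 ≤ sin (ϑ s) :=
      sin_nonneg_of_nonneg_of_le_pi (hmem' s hs).1 (by linarith [(hmem' s hs).2, pi_pos])
    have hcos : 0 ≤ cos (ϑ s) :=
      cos_nonneg_of_neg_pi_div_two_le_of_le (by linarith [(hmem' s hs).1, pi_pos]) (hmem' s hs).2
    have hslope : delaunaySlope 1 t √(angleRadiusSq t (ϑ s)) =
        (2 * t - 1) * sin (ϑ s) * cos (ϑ s) / (angleRadiusSq t (ϑ s) + t * (1 - t)) := by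
      rw [delaunaySlope, hquot s hs, sqrt_sq (by positivity)]
    rw [hslope]
    have hX' : HasDerivAt (angleRadiusSq t)
        ((2 * t - 1) * (2 * cos (ϑ s) * -sin (ϑ s))) (ϑ s) := by
      refine ((((hasDerivAt_cos (ϑ s)).pow 2).const_mul (2 * t - 1)).const_add
        ((1 - t) ^ 2)).congr_deriv ?_
      simp
    refine (((hX'.comp s (hder s)).sqrt hX.ne').congr_deriv ?_).hasDerivWithinAt
    have hr : 0 < √(angleRadiusSq t (ϑ s)) := sqrt_pos.2 hX
    have hw : heightDensity t (ϑ s)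
        = (angleRadiusSq t (ϑ s) + t * (1 - t)) / √(angleRadiusSq t (ϑ s)) := by
      rw [heightDensity, add_div, div_sqrt]
    rw [hW (hmem s hs), hw, Function.comp_apply]
    field_simp
  · simp only [ha, h.angleRadiusSq_radiusAngle]
    exact sqrt_sq h.pos.le

theorem delaunayHeights_eq (h : Reaches a t) : delaunayHeights a 1 t = {angleHeight a t} := by
  refine eq_singleton_iff_unique_mem.2 ⟨⟨h.angleHeight_pos.le, h.exists_profile⟩, ?_⟩
  rintro s ⟨hs, c, hc, hcs⟩
  exact h.height_eq_of_profile hs hc hcs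

theorem delaunayHeight_eq (h : Reaches a t) : delaunayHeight a 1 t = angleHeight a t := by
  rw [delaunayHeight, h.delaunayHeights_eq, csInf_singleton]

end Reaches

/-! ### The function `g` and its zero -/

theorem gFun_strictMonoOn : StrictMonoOn gFun (Ioo 0 1) := by
  intro a ha b hb hab
  have hb2 : 0 < 1 - b ^ 2 := by nlinarith [hb.1, hb.2]
  have hs : √(1 - b ^ 2) < √(1 - a ^ 2) :=
    sqrt_lt_sqrt hb2.le (by nlinarith [ha.1])
  have hsb : 0 < √(1 - b ^ 2) := sqrt_pos.2 hb2
  have h1 : 1 / √(1 - a ^ 2) < 1 / √(1 - b ^ 2) := one_div_lt_one_div_of_lt hsb hs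
  have h2 : log ((1 + √(1 - b ^ 2)) / b) < log ((1 + √(1 - a ^ 2)) / a) := by
    have := ha.1
    have := hb.1
    refine log_lt_log (by positivity) ?_
    gcongr
  simp only [gFun]
  linarith

theorem continuousOn_gFun : ContinuousOn gFun (Ioo 0 1) := by
  have hs : ContinuousOn (fun a : ℝ => √(1 - a ^ 2)) (Ioo 0 1) := by fun_prop
  have h1 : ∀ a ∈ Ioo (0 : ℝ) 1, √(1 - a ^ 2) ≠ 0 := fun a ha =>
    (sqrt_pos.2 (by nlinarith [ha.1, ha.2])).ne'
  have h2 : ∀ a ∈ Ioo (0 : ℝ) 1, (1 + √(1 - a ^ 2)) / a ≠ 0 := fun a ha => by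
    have := ha.1
    positivity
  exact (((continuousOn_const.add hs).div continuousOn_id fun a ha => ha.1.ne').log h2).neg.add
    (continuousOn_const.div hs h1)

/-- The points `0.55235` and `0.55245` are `0.5524 ∓ 5·10⁻⁵`. At each of them a rational number
(here `1.1996`) separates the two terms of `gFun`. -/
theorem gFun_neg_of_left : gFun 0.55235 < 0 := by
  have hs1 : (0.833612 : ℝ) ≤ √(1 - 0.55235 ^ 2) := le_sqrt_of_sq_le (by norm_num)
  have h1 : 1 / √(1 - 0.55235 ^ 2) ≤ (1.1996 : ℝ) := by
    rw [div_le_iff₀ (by linarith)]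
    linarith
  have h2 : (1.1996 : ℝ) < log ((1 + √(1 - 0.55235 ^ 2)) / 0.55235) := by
    rw [lt_log_iff_exp_lt (by positivity)]
    -- `exp_bound'` requires an exponent in `[0, 1]`, hence half of `1.1996`, squared afterwards.
    have he : exp (0.5998 : ℝ) < 1.8219 := by
      refine (exp_bound' (by norm_num) (by norm_num) (n := 7) (by norm_num)).trans_lt ?_
      norm_num [Finset.sum_range_succ, Nat.factorial]
    have : exp (1.1996 : ℝ) = exp 0.5998 ^ 2 := by rw [← exp_nat_mul]; norm_num
    rw [this, lt_div_iff₀ (by norm_num)]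
    have : exp (0.5998 : ℝ) ^ 2 < 1.8219 ^ 2 := by gcongr
    linarith
  simp only [gFun]
  linarith

theorem gFun_pos_of_right : 0 < gFun 0.55245 := by
  have hs1 : √(1 - 0.55245 ^ 2) ≤ (0.833547 : ℝ) := sqrt_le_iff.2 (by norm_num)
  have hs0 : 0 < √(1 - (0.55245 : ℝ) ^ 2) := sqrt_pos.2 (by norm_num)
  have h1 : (1.19968 : ℝ) ≤ 1 / √(1 - 0.55245 ^ 2) := by
    rw [le_div_iff₀ hs0]
    linarith
  have h2 : log ((1 + √(1 - 0.55245 ^ 2)) / 0.55245) < (1.19968 : ℝ) := by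
    rw [log_lt_iff_lt_exp (by positivity)]
    have he : (1.8218 : ℝ) < exp (0.59984 : ℝ) := by
      refine lt_of_lt_of_le ?_ (sum_le_exp_of_nonneg (by norm_num) 8)
      norm_num [Finset.sum_range_succ, Nat.factorial]
    have : exp (1.19968 : ℝ) = exp 0.59984 ^ 2 := by rw [← exp_nat_mul]; norm_num
    rw [this, div_lt_iff₀ (by norm_num)]
    have : (1.8218 : ℝ) ^ 2 < exp (0.59984 : ℝ) ^ 2 := by gcongr
    linarith
  simp only [gFun]
  linarith

theorem exists_gFun_eq_zero : ∃ a₀ ∈ Ioo (0.55235 : ℝ) 0.55245, gFun a₀ = 0 :=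
  intermediate_value_Ioo (by norm_num)
    (continuousOn_gFun.mono (Icc_subset_Ioo (by norm_num) (by norm_num)))
    ⟨gFun_neg_of_left, gFun_pos_of_right⟩

theorem rpow_three_halves {x : ℝ} (hx : 0 ≤ x) : x ^ (3 / 2 : ℝ) = √x ^ 3 := by
  rw [sqrt_eq_rpow, ← rpow_natCast, ← rpow_mul hx]
  norm_num

/-- At a zero of `g` the logarithm equals `1 / √(1 - a²)`, and `(1 - a²) + (a² - 2) = -1`. -/
theorem hFun_eq_of_gFun_eq_zero {a : ℝ} (ha : a ∈ Ioo 0 1) (hg : gFun a = 0) :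
    hFun a = -1 / (1 - a ^ 2) ^ (3 / 2 : ℝ) := by
  have h0 : 0 < 1 - a ^ 2 := by nlinarith [ha.1, ha.2]
  have hs : 0 < √(1 - a ^ 2) := sqrt_pos.2 h0
  have hsq := sq_sqrt h0.le
  have hlog : log ((1 + √(1 - a ^ 2)) / a) = 1 / √(1 - a ^ 2) := by
    rw [gFun] at hg; linarith
  rw [hFun, hlog, rpow_three_halves h0.le]
  field_simp
  linarith

/-! ### Differentiating the height in the radius parameter -/

/-- The first derivative of the height density with respect to the radius parameter. -/
noncomputable def heightDensityDeriv (t φ : ℝ) : ℝ :=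
  (t - 1 + cos φ ^ 2) / √(angleRadiusSq t φ) + (1 - 2 * t) / √(angleRadiusSq t φ)
    - t * (1 - t) * (t - 1 + cos φ ^ 2) / √(angleRadiusSq t φ) ^ 3

/-- The second derivative of the height density with respect to the radius parameter. -/
noncomputable def heightDensityDeriv₂ (t φ : ℝ) : ℝ :=
  -1 / √(angleRadiusSq t φ) - (t - 1 + cos φ ^ 2) ^ 2 / √(angleRadiusSq t φ) ^ 3
    - (2 * (1 - 2 * t) * (t - 1 + cos φ ^ 2) + t * (1 - t)) / √(angleRadiusSq t φ) ^ 3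
    + 3 * (t * (1 - t) * (t - 1 + cos φ ^ 2) ^ 2) / √(angleRadiusSq t φ) ^ 5

/-- The derivative of `radiusAngle t a` with respect to `t`. -/
noncomputable def radiusAngleDeriv (a t : ℝ) : ℝ :=
  (a ^ 2 - t + t ^ 2) / ((2 * t - 1) * √((a ^ 2 - (1 - t) ^ 2) * (t ^ 2 - a ^ 2)))

/-- The derivative of the height with respect to the radius parameter. -/
noncomputable def angleHeightDeriv (a t : ℝ) : ℝ :=
  (∫ φ in (0 : ℝ)..radiusAngle t a, heightDensityDeriv t φ)
    + (a + t * (1 - t) / a) * radiusAngleDeriv a t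

theorem hasDerivAt_sqrt_angleRadiusSq {t φ : ℝ} (h : 0 < angleRadiusSq t φ) :
    HasDerivAt (fun t => √(angleRadiusSq t φ))
      ((t - 1 + cos φ ^ 2) / √(angleRadiusSq t φ)) t := by
  have h1 : HasDerivAt (fun t => angleRadiusSq t φ) (2 * (t - 1 + cos φ ^ 2)) t := by
    have := (((hasDerivAt_id t).const_sub 1).pow 2).add
      ((((hasDerivAt_id t).const_mul 2).sub_const 1).mul_const (cos φ ^ 2))
    refine this.congr_deriv ?_
    simp
    ring
  refine (h1.sqrt h.ne').congr_deriv ?_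
  have := sqrt_pos.2 h
  field_simp

theorem hasDerivAt_heightDensity {t φ : ℝ} (h : 0 < angleRadiusSq t φ) :
    HasDerivAt (fun t => heightDensity t φ) (heightDensityDeriv t φ) t := by
  have hr := hasDerivAt_sqrt_angleRadiusSq h
  have h0 := sqrt_pos.2 h
  have h1 : HasDerivAt (fun t : ℝ => t * (1 - t)) (1 - 2 * t) t := by
    refine ((hasDerivAt_id t).mul ((hasDerivAt_id t).const_sub 1)).congr_deriv ?_
    simp only [id]; ring
  refine (hr.add (h1.div hr h0.ne')).congr_deriv ?_
  simp only [heightDensityDeriv]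
  field_simp
  ring

theorem hasDerivAt_heightDensityDeriv {t φ : ℝ} (h : 0 < angleRadiusSq t φ) :
    HasDerivAt (fun t => heightDensityDeriv t φ) (heightDensityDeriv₂ t φ) t := by
  have hr := hasDerivAt_sqrt_angleRadiusSq h
  have h0 := sqrt_pos.2 h
  have h1 : HasDerivAt (fun t : ℝ => t * (1 - t)) (1 - 2 * t) t := by
    refine ((hasDerivAt_id t).mul ((hasDerivAt_id t).const_sub 1)).congr_deriv ?_
    simp only [id]; ring
  have h2 : HasDerivAt (fun t : ℝ => t - 1 + cos φ ^ 2) 1 t :=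
    ((hasDerivAt_id t).sub_const 1).add_const _
  have h3 : HasDerivAt (fun t : ℝ => 1 - 2 * t) (-2) t := by
    refine (((hasDerivAt_id t).const_mul 2).const_sub 1).congr_deriv ?_
    simp
  refine (((h2.div hr h0.ne').add (h3.div hr h0.ne')).sub
    ((h1.mul h2).div (hr.pow 3) (pow_pos h0 3).ne')).congr_deriv ?_
  simp only [heightDensityDeriv₂, Pi.mul_apply, Pi.pow_apply]
  field_simp
  ring

theorem continuous_uncurry_sqrt_angleRadiusSq :
    Continuous fun p : ℝ × ℝ => √(angleRadiusSq p.1 p.2) := by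
  unfold angleRadiusSq
  fun_prop

theorem isOpen_angleRadiusSq_pos : IsOpen {p : ℝ × ℝ | 0 < angleRadiusSq p.1 p.2} := by
  unfold angleRadiusSq
  exact isOpen_lt continuous_const (by fun_prop)

theorem continuousOn_uncurry_heightDensity :
    ContinuousOn (Function.uncurry heightDensity) {p | 0 < angleRadiusSq p.1 p.2} := by
  have hr := continuous_uncurry_sqrt_angleRadiusSq.continuousOn
    (s := {p : ℝ × ℝ | 0 < angleRadiusSq p.1 p.2})
  have hne : ∀ p ∈ {p : ℝ × ℝ | 0 < angleRadiusSq p.1 p.2}, √(angleRadiusSq p.1 p.2) ≠ 0 :=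
    fun p hp => (sqrt_pos.2 hp).ne'
  exact hr.add (ContinuousOn.div (by fun_prop) hr hne)

theorem continuousOn_uncurry_heightDensityDeriv :
    ContinuousOn (Function.uncurry heightDensityDeriv) {p | 0 < angleRadiusSq p.1 p.2} := by
  have hr := continuous_uncurry_sqrt_angleRadiusSq.continuousOn
    (s := {p : ℝ × ℝ | 0 < angleRadiusSq p.1 p.2})
  have hne : ∀ p ∈ {p : ℝ × ℝ | 0 < angleRadiusSq p.1 p.2}, √(angleRadiusSq p.1 p.2) ≠ 0 :=
    fun p hp => (sqrt_pos.2 hp).ne'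
  exact ((ContinuousOn.div (by fun_prop) hr hne).add (ContinuousOn.div (by fun_prop) hr hne)).sub
    (ContinuousOn.div (by fun_prop) (hr.pow 3) fun p hp => pow_ne_zero 3 (hne p hp))

theorem continuousOn_uncurry_heightDensityDeriv₂ :
    ContinuousOn (Function.uncurry heightDensityDeriv₂) {p | 0 < angleRadiusSq p.1 p.2} := by
  have hr := continuous_uncurry_sqrt_angleRadiusSq.continuousOn
    (s := {p : ℝ × ℝ | 0 < angleRadiusSq p.1 p.2})
  have hne : ∀ p ∈ {p : ℝ × ℝ | 0 < angleRadiusSq p.1 p.2}, √(angleRadiusSq p.1 p.2) ≠ 0 :=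
    fun p hp => (sqrt_pos.2 hp).ne'
  exact (((ContinuousOn.div (by fun_prop) hr hne).sub
    (ContinuousOn.div (by fun_prop) (hr.pow 3) fun p hp => pow_ne_zero 3 (hne p hp))).sub
    (ContinuousOn.div (by fun_prop) (hr.pow 3) fun p hp => pow_ne_zero 3 (hne p hp))).add
    (ContinuousOn.div (by fun_prop) (hr.pow 5) fun p hp => pow_ne_zero 5 (hne p hp))

theorem Reaches.hasDerivAt_radiusAngle_param {a t : ℝ} (h : Reaches a t) :
    HasDerivAt (fun t => radiusAngle t a) (radiusAngleDeriv a t) t := by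
  have hm := h.coeff_pos
  have hy : HasDerivAt (fun t : ℝ => (a ^ 2 - (1 - t) ^ 2) / (2 * t - 1))
      (-(2 * (a ^ 2 - t + t ^ 2)) / (2 * t - 1) ^ 2) t := by
    refine ((((hasDerivAt_id t).const_sub 1).pow 2).const_sub (a ^ 2)).div
      (((hasDerivAt_id t).const_mul 2).sub_const 1) hm.ne' |>.congr_deriv ?_
    simp
    congr 1
    ring
  refine (hasDerivAt_arccos_sqrt hy h.ratio_pos h.ratio_lt_one).congr_deriv ?_
  have h1 : (a ^ 2 - (1 - t) ^ 2) / (2 * t - 1) * (1 - (a ^ 2 - (1 - t) ^ 2) / (2 * t - 1))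
      = (a ^ 2 - (1 - t) ^ 2) * (t ^ 2 - a ^ 2) / (2 * t - 1) ^ 2 := by
    rw [one_sub_div hm.ne', div_mul_div_comm, ← pow_two]
    congr 1
    ring
  rw [h1, sqrt_div' _ (sq_nonneg _), sqrt_sq hm.le, radiusAngleDeriv]
  have h2 : 0 < √((a ^ 2 - (1 - t) ^ 2) * (t ^ 2 - a ^ 2)) :=
    sqrt_pos.2 (mul_pos (sub_pos.2 h.sq_lt) (by nlinarith [h.pos, h.lt]))
  field_simp

theorem Reaches.hasDerivAt_angleHeight {a t : ℝ} (h : Reaches a t) :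
    HasDerivAt (angleHeight a) (angleHeightDeriv a t) t := by
  have := hasDerivAt_intervalIntegral_of_continuousOn isOpen_angleRadiusSq_pos
    continuousOn_uncurry_heightDensity continuousOn_uncurry_heightDensityDeriv
    (fun p hp => hasDerivAt_heightDensity hp) h.hasDerivAt_radiusAngle_param
    (by rw [uIcc_of_le h.radiusAngle_pos.le]; exact fun φ hφ => h.angleRadiusSq_pos hφ)
  rwa [h.heightDensity_radiusAngle] at this

theorem reaches_one {a : ℝ} (ha : a ∈ Ioo 0 1) : Reaches a 1 :=
  ⟨ha.1, ha.2, by simpa using ha.1, by simpa using pow_pos ha.1 2⟩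

theorem eventually_reaches {a t : ℝ} (h : Reaches a t) : ∀ᶠ s in nhds t, Reaches a s := by
  have h1 : ∀ᶠ s in nhds t, a < s := lt_mem_nhds h.lt
  have h2 : ∀ᶠ s in nhds t, |1 - s| < a :=
    ((continuous_const.sub continuous_id).abs.tendsto t).eventually_lt_const h.abs_lt
  have h3 : ∀ᶠ s in nhds t, s ^ 2 - s < a ^ 2 :=
    (((continuous_id.pow 2).sub continuous_id).tendsto t).eventually_lt_const h.denom
  filter_upwards [h1, h2, h3] with s h1 h2 h3 using ⟨h.pos, h1, h2, h3⟩

/-! ### Evaluation at the circle `t = 1` -/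

section RadiusOne

variable {a : ℝ}

theorem radiusAngle_one (ha : a ∈ Ioo 0 1) : radiusAngle 1 a = arccos a := by
  rw [radiusAngle]
  norm_num
  rw [sqrt_sq ha.1.le]

theorem sqrt_angleRadiusSq_one {φ : ℝ} (h : 0 ≤ cos φ) : √(angleRadiusSq 1 φ) = cos φ := by
  rw [angleRadiusSq]
  norm_num
  exact sqrt_sq h

theorem cos_pos_of_mem_arccos (ha : a ∈ Ioo 0 1) {φ : ℝ} (hφ : φ ∈ Icc 0 (arccos a)) :
    0 < cos φ :=
  cos_pos_of_mem_Ioo ⟨by linarith [hφ.1, pi_pos],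
    hφ.2.trans_lt (arccos_lt_pi_div_two.2 ha.1)⟩

theorem angleHeight_one (ha : a ∈ Ioo 0 1) : angleHeight a 1 = √(1 - a ^ 2) := by
  rw [angleHeight, radiusAngle_one ha, ← sin_arccos]
  rw [intervalIntegral.integral_congr (g := cos), integral_cos, sin_zero, sub_zero]
  rw [uIcc_of_le (arccos_nonneg a)]
  intro φ hφ
  simp [heightDensity, sqrt_angleRadiusSq_one (cos_pos_of_mem_arccos ha hφ).le]

/-- Serves both derivatives: at `t = 1` the first and second `t`-derivatives of the density are `cos
φ - 1 / cos φ` and its negative. -/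
theorem integral_inv_cos_sub_cos (ha : a ∈ Ioo 0 1) :
    ∫ φ in (0 : ℝ)..arccos a, (1 / cos φ - cos φ)
      = log ((1 + √(1 - a ^ 2)) / a) - √(1 - a ^ 2) := by
  have hcont : ContinuousOn (fun φ => 1 / cos φ - cos φ) (uIcc 0 (arccos a)) := by
    rw [uIcc_of_le (arccos_nonneg a)]
    exact (continuousOn_const.div continuous_cos.continuousOn
      fun φ hφ => (cos_pos_of_mem_arccos ha hφ).ne').sub continuous_cos.continuousOn
  have hder : ∀ φ ∈ uIcc 0 (arccos a),
      HasDerivAt (fun φ => log ((1 + sin φ) / cos φ) - sin φ) (1 / cos φ - cos φ) φ := by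
    intro φ hφ
    rw [uIcc_of_le (arccos_nonneg a)] at hφ
    have hc := cos_pos_of_mem_arccos ha hφ
    have hs : 0 ≤ sin φ := sin_nonneg_of_nonneg_of_le_pi hφ.1 (hφ.2.trans (arccos_le_pi a))
    have h1 : 0 < 1 + sin φ := by linarith
    refine (((((hasDerivAt_sin φ).const_add 1).div (hasDerivAt_cos φ) hc.ne').log
      (div_pos h1 hc).ne').sub (hasDerivAt_sin φ)).congr_deriv ?_
    congr 1
    simp only [Pi.div_apply]
    field_simp
    nlinarith [sin_sq_add_cos_sq φ]
  rw [intervalIntegral.integral_eq_sub_of_hasDerivAt hder hcont.intervalIntegrable,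
    sin_arccos, cos_arccos (by linarith [ha.1]) ha.2.le]
  simp

theorem sqrt_one_sub_sq_pos (ha : a ∈ Ioo 0 1) : 0 < √(1 - a ^ 2) :=
  sqrt_pos.2 (by nlinarith [ha.1, ha.2])

theorem radiusAngleDeriv_one (ha : a ∈ Ioo 0 1) :
    radiusAngleDeriv a 1 = a / √(1 - a ^ 2) := by
  have hs := sqrt_one_sub_sq_pos ha
  have ha0 := ha.1
  rw [radiusAngleDeriv]
  norm_num
  rw [sqrt_mul (sq_nonneg a), sqrt_sq ha0.le]
  field_simp

theorem angleHeightDeriv_one (ha : a ∈ Ioo 0 1) : angleHeightDeriv a 1 = gFun a := by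
  have hs := sqrt_one_sub_sq_pos ha
  have hsq : √(1 - a ^ 2) ^ 2 = 1 - a ^ 2 := sq_sqrt (by nlinarith [ha.1, ha.2])
  have hI : ∫ φ in (0 : ℝ)..arccos a, heightDensityDeriv 1 φ
      = -(log ((1 + √(1 - a ^ 2)) / a) - √(1 - a ^ 2)) := by
    rw [← integral_inv_cos_sub_cos ha, ← intervalIntegral.integral_neg]
    refine intervalIntegral.integral_congr fun φ hφ => ?_
    rw [uIcc_of_le (arccos_nonneg a)] at hφ
    have hc := cos_pos_of_mem_arccos ha hφ
    simp only [heightDensityDeriv, sqrt_angleRadiusSq_one hc.le]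
    field_simp
    ring
  rw [angleHeightDeriv, radiusAngle_one ha, hI, radiusAngleDeriv_one ha, gFun]
  have ha0 := ha.1
  field_simp
  linarith

theorem hasDerivAt_radiusAngleDeriv_one (ha : a ∈ Ioo 0 1) :
    HasDerivAt (radiusAngleDeriv a)
      ((1 - 2 * a ^ 2) / (a * √(1 - a ^ 2)) - a / √(1 - a ^ 2) ^ 3) 1 := by
  have hs := sqrt_one_sub_sq_pos ha
  have hsq : √(1 - a ^ 2) ^ 2 = 1 - a ^ 2 := sq_sqrt (by nlinarith [ha.1, ha.2])
  have ha0 := ha.1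
  have hR : HasDerivAt (fun t : ℝ => (a ^ 2 - (1 - t) ^ 2) * (t ^ 2 - a ^ 2)) (2 * a ^ 2) 1 := by
    refine (((((hasDerivAt_id (1 : ℝ)).const_sub 1).pow 2).const_sub (a ^ 2)).mul
      (((hasDerivAt_id (1 : ℝ)).pow 2).sub_const (a ^ 2))).congr_deriv ?_
    simp
    ring
  have hR1 : (a ^ 2 - (1 - (1 : ℝ)) ^ 2) * (1 ^ 2 - a ^ 2) = (a * √(1 - a ^ 2)) ^ 2 := by
    rw [mul_pow, hsq]; ring
  have hN : HasDerivAt (fun t : ℝ => a ^ 2 - t + t ^ 2) 1 1 := by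
    refine (((hasDerivAt_id (1 : ℝ)).const_sub (a ^ 2)).add
      ((hasDerivAt_id (1 : ℝ)).pow 2)).congr_deriv ?_
    norm_num
  have hM : HasDerivAt (fun t : ℝ => 2 * t - 1) 2 1 := by
    simpa using ((hasDerivAt_id (1 : ℝ)).const_mul 2).sub_const 1
  have hsqrt := hR.sqrt (by rw [hR1]; positivity)
  have hval : √((a ^ 2 - (1 - (1 : ℝ)) ^ 2) * (1 ^ 2 - a ^ 2)) = a * √(1 - a ^ 2) := by
    rw [hR1, sqrt_sq (by positivity)]
  refine (hN.div (hM.mul hsqrt) ?_).congr_deriv ?_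
  · simp only [Pi.mul_apply, hval]
    norm_num
    exact ⟨ha0.ne', hs.ne'⟩
  · simp only [Pi.mul_apply, hval]
    norm_num
    field_simp
    ring

theorem hasDerivAt_angleHeightDeriv_one (ha : a ∈ Ioo 0 1) :
    HasDerivAt (angleHeightDeriv a) (hFun a) 1 := by
  have h := reaches_one ha
  have hs := sqrt_one_sub_sq_pos ha
  have h1a : 0 < 1 - a ^ 2 := by nlinarith [ha.1, ha.2]
  have hsq : √(1 - a ^ 2) ^ 2 = 1 - a ^ 2 := sq_sqrt h1a.le
  have ha0 := ha.1
  have hI := hasDerivAt_intervalIntegral_of_continuousOn isOpen_angleRadiusSq_pos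
    continuousOn_uncurry_heightDensityDeriv continuousOn_uncurry_heightDensityDeriv₂
    (fun p hp => hasDerivAt_heightDensityDeriv hp) h.hasDerivAt_radiusAngle_param
    (by rw [uIcc_of_le h.radiusAngle_pos.le]; exact fun φ hφ => h.angleRadiusSq_pos hφ)
  have hB : HasDerivAt (fun t : ℝ => a + t * (1 - t) / a) (-1 / a) 1 := by
    refine ((((hasDerivAt_id (1 : ℝ)).mul ((hasDerivAt_id (1 : ℝ)).const_sub 1)).div_const
      a).const_add a).congr_deriv ?_
    simp
  refine (hI.add (hB.mul (hasDerivAt_radiusAngleDeriv_one ha))).congr_deriv ?_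
  have hint : ∫ φ in (0 : ℝ)..arccos a, heightDensityDeriv₂ 1 φ
      = log ((1 + √(1 - a ^ 2)) / a) - √(1 - a ^ 2) := by
    rw [← integral_inv_cos_sub_cos ha]
    refine intervalIntegral.integral_congr fun φ hφ => ?_
    rw [uIcc_of_le (arccos_nonneg a)] at hφ
    have hc := cos_pos_of_mem_arccos ha hφ
    simp only [heightDensityDeriv₂, sqrt_angleRadiusSq_one hc.le]
    field_simp
    ring
  have hw : heightDensityDeriv 1 (arccos a) = a - 1 / a := by
    have hcos : cos (arccos a) = a := cos_arccos (by linarith) ha.2.le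
    rw [heightDensityDeriv, sqrt_angleRadiusSq_one (by rw [hcos]; exact ha0.le), hcos]
    field_simp
    ring
  rw [radiusAngle_one ha, hint, hw, radiusAngleDeriv_one ha, hFun, rpow_three_halves h1a.le]
  -- With the logarithm and the root as free variables `l` and `s`, only `a² = 1 - s²` is needed.
  have h4 : a ^ 2 = 1 - √(1 - a ^ 2) ^ 2 := by rw [hsq]; ring
  generalize log ((1 + √(1 - a ^ 2)) / a) = l
  generalize √(1 - a ^ 2) = s at *
  field_simp
  linear_combination -(a ^ 2 * (2 + s ^ 2)) * h4

end RadiusOne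

/-! ### Local signs from derivatives, and the conclusion -/

theorem HasDerivAt.eventually_sign_of_pos {f : ℝ → ℝ} {f' x₀ : ℝ} (hf : HasDerivAt f f' x₀)
    (hf' : 0 < f') :
    ∀ᶠ x in nhds x₀, (x < x₀ → f x < f x₀) ∧ (x₀ < x → f x₀ < f x) := by
  have h := (hasDerivAt_iff_tendsto_slope.1 hf).eventually_const_lt hf'
  rw [eventually_nhdsWithin_iff] at h
  filter_upwards [h] with x hx
  refine ⟨fun hlt => ?_, fun hlt => ?_⟩
  · have := hx hlt.ne
    rw [slope_comm, slope_def_field, div_pos_iff_of_pos_right (sub_pos.2 hlt)] at this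
    linarith
  · have := hx hlt.ne'
    rw [slope_def_field, div_pos_iff_of_pos_right (sub_pos.2 hlt)] at this
    linarith

theorem HasDerivAt.eventually_sign_of_neg {f : ℝ → ℝ} {f' x₀ : ℝ} (hf : HasDerivAt f f' x₀)
    (hf' : f' < 0) :
    ∀ᶠ x in nhds x₀, (x < x₀ → f x₀ < f x) ∧ (x₀ < x → f x < f x₀) := by
  filter_upwards [hf.neg.eventually_sign_of_pos (neg_pos.2 hf')] with x hx
  simpa using hx

/-- Near `x₀` the derivative is positive on the left and negative on the right; the mean value
theorem between `x₀` and `x` then gives strict inequality. -/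
theorem eventually_lt_of_hasDerivAt_of_second_neg {f f' : ℝ → ℝ} {f'' x₀ : ℝ}
    (hf : ∀ᶠ x in nhds x₀, HasDerivAt f (f' x) x) (h0 : f' x₀ = 0)
    (hf' : HasDerivAt f' f'' x₀) (hneg : f'' < 0) :
    ∀ᶠ x in nhds x₀, x ≠ x₀ → f x < f x₀ := by
  obtain ⟨ε, hε, hball⟩ :=
    Metric.eventually_nhds_iff_ball.1 (hf.and (hf'.eventually_sign_of_neg hneg))
  filter_upwards [Metric.ball_mem_nhds x₀ hε] with x hx hne
  have hsub : uIcc x₀ x ⊆ Metric.ball x₀ ε :=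
    (convex_ball _ _).ordConnected.uIcc_subset (Metric.mem_ball_self hε) hx
  rcases lt_or_gt_of_ne hne with hlt | hlt
  · rw [uIcc_of_ge hlt.le] at hsub
    obtain ⟨ξ, hξ, hs⟩ := exists_hasDerivAt_eq_slope f f' hlt
      (fun y hy => (hball y (hsub hy)).1.continuousAt.continuousWithinAt)
      (fun y hy => (hball y (hsub (Ioo_subset_Icc_self hy))).1)
    have := (hball ξ (hsub (Ioo_subset_Icc_self hξ))).2.1 hξ.2
    rw [h0, hs, div_pos_iff_of_pos_right (sub_pos.2 hlt)] at this
    linarith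
  · rw [uIcc_of_le hlt.le] at hsub
    obtain ⟨ξ, hξ, hs⟩ := exists_hasDerivAt_eq_slope f f' hlt
      (fun y hy => (hball y (hsub hy)).1.continuousAt.continuousWithinAt)
      (fun y hy => (hball y (hsub (Ioo_subset_Icc_self hy))).1)
    have := (hball ξ (hsub (Ioo_subset_Icc_self hξ))).2.2 hξ.1
    rw [h0, hs, div_neg_iff] at this
    rcases this with h | h <;> linarith

theorem Reaches.hasDerivAt_heightExcess {a t : ℝ} (h : Reaches a t) :
    HasDerivAt (heightExcess a) (angleHeightDeriv a t) t := by
  refine (h.hasDerivAt_angleHeight.sub_const √(1 - a ^ 2)).congr_of_eventuallyEq ?_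
  filter_upwards [eventually_reaches h] with s hs
  rw [heightExcess, hs.delaunayHeight_eq]

theorem mainTheorem4 :
    ∃ a₀ : ℝ, 1 / 2 < a₀ ∧ a₀ < 1 ∧ |a₀ - 0.5524| < 0.00005 ∧
      (∀ a ∈ Ioo (0 : ℝ) 1, gFun a = 0 ↔ a = a₀) ∧
      hFun a₀ = -1 / (1 - a₀ ^ 2) ^ (3 / 2 : ℝ) ∧ hFun a₀ < 0 ∧
      ∀ a ∈ Ioo (0 : ℝ) 1, ∃ η : ℝ, 0 < η ∧
        (∀ t ∈ Icc (1 - η) (1 + η), delaunayHeights a 1 t = {delaunayHeight a 1 t}) ∧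
        delaunayHeight a 1 1 = √(1 - a ^ 2) ∧
        (∀ t ∈ Icc (1 - η) (1 + η), DifferentiableAt ℝ (heightExcess a) t) ∧
        HasDerivAt (heightExcess a) (gFun a) 1 ∧
        HasDerivAt (deriv (heightExcess a)) (hFun a) 1 ∧
        (a₀ < a → 0 < gFun a ∧
          (∀ t ∈ Ico (1 - η) 1, delaunayHeight a 1 t < √(1 - a ^ 2)) ∧
          (∀ t ∈ Ioc 1 (1 + η), √(1 - a ^ 2) < delaunayHeight a 1 t)) ∧
        (a < a₀ → gFun a < 0 ∧
          (∀ t ∈ Ico (1 - η) 1, √(1 - a ^ 2) < delaunayHeight a 1 t) ∧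
          (∀ t ∈ Ioc 1 (1 + η), delaunayHeight a 1 t < √(1 - a ^ 2))) ∧
        (a = a₀ → ∀ t : ℝ, 0 < |t - 1| → |t - 1| ≤ η →
          delaunayHeight a 1 t < √(1 - a ^ 2)) := by
  obtain ⟨a₀, ha₀, hg₀⟩ := exists_gFun_eq_zero
  have hmem : a₀ ∈ Ioo (0 : ℝ) 1 := ⟨by linarith [ha₀.1], by linarith [ha₀.2]⟩
  have hh := hFun_eq_of_gFun_eq_zero hmem hg₀
  have hhneg : hFun a₀ < 0 := by
    rw [hh]
    exact div_neg_of_neg_of_pos (by norm_num)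
      (rpow_pos_of_pos (by nlinarith [hmem.1, hmem.2]) _)
  refine ⟨a₀, by linarith [ha₀.1], hmem.2, ?_, ?_, hh, hhneg, ?_⟩
  · rw [abs_lt]
    constructor <;> linarith [ha₀.1, ha₀.2]
  · exact fun a ha => ⟨fun hg => gFun_strictMonoOn.injOn ha hmem (hg.trans hg₀.symm),
      fun h => h ▸ hg₀⟩
  intro a ha
  have hR := reaches_one ha
  have hev := eventually_reaches hR
  have hd : HasDerivAt (heightExcess a) (gFun a) 1 := by
    rw [← angleHeightDeriv_one ha]
    exact hR.hasDerivAt_heightExcess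
  have hone : delaunayHeight a 1 1 = √(1 - a ^ 2) := by
    rw [hR.delaunayHeight_eq, angleHeight_one ha]
  have hzero : heightExcess a 1 = 0 := by rw [heightExcess, hone, sub_self]
  have hlocal : ∀ᶠ t in nhds (1 : ℝ),
      (a₀ < a → (t < 1 → heightExcess a t < 0) ∧ (1 < t → 0 < heightExcess a t)) ∧
      (a < a₀ → (t < 1 → 0 < heightExcess a t) ∧ (1 < t → heightExcess a t < 0)) ∧
      (a = a₀ → t ≠ 1 → heightExcess a t < 0) := by
    rcases lt_trichotomy a a₀ with hlt | heq | hgt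
    · have hg : gFun a < 0 := hg₀ ▸ gFun_strictMonoOn ha hmem hlt
      filter_upwards [hd.eventually_sign_of_neg hg] with t ht
      rw [hzero] at ht
      exact ⟨fun h => absurd h hlt.not_gt, fun _ => ht, fun h => absurd h hlt.ne⟩
    · have := eventually_lt_of_hasDerivAt_of_second_neg
        (hev.mono fun t ht => ht.hasDerivAt_heightExcess)
        ((angleHeightDeriv_one ha).trans (heq ▸ hg₀)) (hasDerivAt_angleHeightDeriv_one ha)
        (heq ▸ hhneg)
      filter_upwards [this] with t ht
      rw [hzero] at ht
      exact ⟨fun h => absurd h heq.not_gt, fun h => absurd h heq.not_lt, fun _ => ht⟩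
    · have hg : 0 < gFun a := hg₀ ▸ gFun_strictMonoOn hmem ha hgt
      filter_upwards [hd.eventually_sign_of_pos hg] with t ht
      rw [hzero] at ht
      exact ⟨fun _ => ht, fun h => absurd h hgt.not_gt, fun h => absurd h hgt.ne'⟩
  -- A closed ball, because the claims include the endpoints `1 ± η`; its radius serves as `η`.
  obtain ⟨ε, hε, hball⟩ := Metric.nhds_basis_closedBall.eventually_iff.1 (hev.and hlocal)
  have hI : ∀ t ∈ Icc (1 - ε) (1 + ε), _ := fun t ht =>
    hball (x := t) (by rwa [Real.closedBall_eq_Icc])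
  refine ⟨ε, hε, fun t ht => ?_, hone, fun t ht => (hI t ht).1.hasDerivAt_heightExcess.differentiableAt,
    hd, ?_, fun h => ⟨hg₀ ▸ gFun_strictMonoOn hmem ha h, fun t ht => ?_, fun t ht => ?_⟩,
    fun h => ⟨hg₀ ▸ gFun_strictMonoOn ha hmem h, fun t ht => ?_, fun t ht => ?_⟩,
    fun h t ht0 ht => ?_⟩
  · rw [(hI t ht).1.delaunayHeight_eq, (hI t ht).1.delaunayHeights_eq]
  · refine (hasDerivAt_angleHeightDeriv_one ha).congr_of_eventuallyEq ?_
    filter_upwards [hev] with t ht using ht.hasDerivAt_heightExcess.deriv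
  · exact sub_neg.1 (((hI t ⟨ht.1, by linarith [ht.2]⟩).2.1 h).1 ht.2)
  · exact sub_pos.1 (((hI t ⟨by linarith [ht.1], ht.2⟩).2.1 h).2 ht.1)
  · exact sub_pos.1 (((hI t ⟨ht.1, by linarith [ht.2]⟩).2.2.1 h).1 ht.2)
  · exact sub_neg.1 (((hI t ⟨by linarith [ht.1], ht.2⟩).2.2.1 h).2 ht.1)
  · have := abs_le.1 ht
    exact sub_neg.1 ((hI t ⟨by linarith [this.1], by linarith [this.2]⟩).2.2.2 h
      (sub_ne_zero.1 (abs_pos.1 ht0)))
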